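/- A project is a pair $(F,c)$ with $F$ a probability distribution on $\mathbb{R}_+$ with finite expectation and $c\ge 0$ a cost. An agent facing a finite set of projects $\mathcal{A}$ with independent prizes $y_a\sim F_a$, and a wage contract $w:\mathbb{R}_+\to\mathbb{R}_+$ (measurable), searches sequentially with recall: as a (measurable) function of the set of projects sampled so far and of the highest wage currently obtainable, he either samples another project of $\mathcal{A}$, paying its cost, or stops and presents a prize that gives him the highest wage among the prizes he has sampled and the prize $0$, which is always available (if several such prizes exist, he presents the largest one). If $y$ is the presented prize, the agent receives $w(y)$ minus the sum of the costs of the sampled projects, and the principal receives $y-w(y)$. Let $\Sigma(w,\mathcal{A})$ be the set of strategies that maximize the agent's expected payoff and put $$V_P(w\mid\mathcal{A}):=\sup_{\sigma\in\Sigma(w,\mathcal{A})}\mathbb{E}_\sigma[y-w(y)],\qquad V_P(w):=\inf_{\mathcal{A}\ni a_0}V_P(w\mid\mathcal{A}),$$ where $a_0=(F_0,c_0)$ is a fixed known project and the infimum is over all finite sets of projects containing $a_0$. Let $s_0:=\mathbb{E}_{F_0}[y]-c_0$ be the surplus of $a_0$. If $c_0>0$ and $s_0>0$, then no linear contract $w(y)=\alpha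 y$ with $\alpha\in[0,1]$ guarantees the full surplus; moreover $$\sup_{\alpha\in[0,1]}V_P\bigl(w(y)=\alpha y\bigr)<s_0 .$$ -/

import Mathlib

open MeasureTheory
open scoped NNReal

noncomputable section

namespace RobustSearch

/-- A project (a Pandora's box) `(F, c)`: a prize distribution `F` on `ℝ₊` with finite
expectation, and a cost `c ∈ ℝ₊` of learning the realized prize. -/
@[ext]
structure Project where
  dist : ProbabilityMeasure ℝ≥0
  cost : ℝ≥0
  finite_expectation : Integrable (fun y : ℝ≥0 => (y : ℝ)) (dist : Measure ℝ≥0)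

instance : DecidableEq Project := Classical.decEq Project

/-- The surplus `s = 𝔼_F[y] - c` of a project. -/
def Project.surplus (a : Project) : ℝ :=
  (∫ y : ℝ≥0, (y : ℝ) ∂(a.dist : Measure ℝ≥0)) - a.cost

/-- A wage contract: a measurable function of the presented prize that satisfies limited
liability. -/
structure Contract where
  wage : ℝ≥0 → ℝ
  measurable_wage : Measurable wage
  wage_nonneg : ∀ y, 0 ≤ wage y

/-- The linear contract `w(y) = α y` with slope `α ∈ [0, 1]`. -/
def linearContract (α : Set.Icc (0 : ℝ) 1) : Contract where
  wage y := (α : ℝ) * (y : ℝ)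
  measurable_wage := by fun_prop
  wage_nonneg y := mul_nonneg α.2.1 y.2

/-- A search strategy for the set of projects `A`. The state is the set `S` of projects sampled
so far together with the highest wage `v` that can currently be obtained; `next S v = some a`
means that the (not yet sampled) project `a` is sampled next and `next S v = none` means that
the search stops. -/
structure Strategy (A : Finset Project) where
  next : Finset A → ℝ → Option A
  not_sampled : ∀ S v a, next S v = some a → a ∉ S
  measurable_next : ∀ S o, MeasurableSet {v : ℝ | next S v = o}

section Search

variable {A : Finset Project}

/-- The prizes that the agent can present after sampling the projects in `S`, when `y` lists the
realized prizes of all projects: those of the sampled projects, and the prize zero. -/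
def availablePrizes (y : A → ℝ≥0) (S : Finset A) : Finset ℝ≥0 :=
  insert 0 (S.image y)

/-- The highest wage among the available prizes. -/
def bestWage (w : Contract) (y : A → ℝ≥0) (S : Finset A) : ℝ :=
  (availablePrizes y S).sup' (Finset.insert_nonempty _ _) w.wage

/-- The prize presented when the search stops after sampling `S`: a prize that gives the agent
the highest available wage; among such prizes ties are broken in favor of the principal, whose
payoff `y - w(y)` is then highest for the largest prize. -/
def presentedPrize (w : Contract) (y : A → ℝ≥0) (S : Finset A) : ℝ≥0 :=
  ((availablePrizes y S).filter fun p => w.wage p = bestWage w y S).sup id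

/-- One step of the search: the set of sampled projects after following `σ` once. -/
def step (w : Contract) (σ : Strategy A) (y : A → ℝ≥0) (S : Finset A) : Finset A :=
  match σ.next S (bestWage w y S) with
  | none => S
  | some a => insert a S

/-- The set of projects that have been sampled when the search under `σ` ends, if the realized
prizes are `y`. A search never takes more than `|A|` steps, and `step` is stationary once `σ`
stops. -/
def sampled (w : Contract) (σ : Strategy A) (y : A → ℝ≥0) : Finset A :=
  (step w σ y)^[Fintype.card A] ∅

/-- The prize presented at the end of the search. -/
def finalPrize (w : Contract) (σ : Strategy A) (y : A → ℝ≥0) : ℝ≥0 :=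
  presentedPrize w y (sampled w σ y)

/-- The joint law of the prizes, which are drawn independently across projects. -/
def prizeLaw (A : Finset Project) : Measure (A → ℝ≥0) :=
  Measure.pi fun a : A => (a.1.dist : Measure ℝ≥0)

/-- The agent's expected payoff: the wage minus the costs of all sampled projects. -/
def agentPayoff (w : Contract) (σ : Strategy A) : ℝ :=
  ∫ y, (w.wage (finalPrize w σ y) - ∑ a ∈ sampled w σ y, (a.1.cost : ℝ)) ∂(prizeLaw A)

/-- The principal's expected payoff `𝔼_σ[y - w(y)]`. -/
def principalPayoff (w : Contract) (σ : Strategy A) : ℝ :=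
  ∫ y, ((finalPrize w σ y : ℝ) - w.wage (finalPrize w σ y)) ∂(prizeLaw A)

end Search

/-- The set `Σ(w, A)` of optimal search strategies of the agent. -/
def optimalStrategies (w : Contract) (A : Finset Project) : Set (Strategy A) :=
  {σ | ∀ τ : Strategy A, agentPayoff w τ ≤ agentPayoff w σ}

/-- `V_P(w | A)`: the principal's payoff when the set of projects is `A`, the agent breaking ties
in favor of the principal. -/
def payoffGiven (w : Contract) (A : Finset Project) : EReal :=
  ⨆ σ ∈ optimalStrategies w A, (principalPayoff w σ : EReal)

/-- `V_P(w)`: the payoff guarantee of `w`, the worst case over all finite sets of projects that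
contain the known project `a₀`. -/
def payoffGuarantee (a₀ : Project) (w : Contract) : EReal :=
  ⨅ (A : Finset Project) (_ : a₀ ∈ A), payoffGiven w A

end RobustSearch

end

noncomputable section

namespace RobustSearch

section LinearContract

variable {A : Finset Project} (α : Set.Icc (0 : ℝ) 1)

lemma sup_availablePrizes (y : A → ℝ≥0) (S : Finset A) :
    (availablePrizes y S).sup id = S.sup y := by
  rw [availablePrizes, Finset.sup_insert, Finset.sup_image]
  simp

lemma bestWage_linearContract (y : A → ℝ≥0) (S : Finset A) :
    bestWage (linearContract α) y S = α * (S.sup y : ℝ≥0) := by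
  rw [← sup_availablePrizes y S]
  apply le_antisymm
  · refine Finset.sup'_le _ _ fun p hp => ?_
    exact mul_le_mul_of_nonneg_left (NNReal.coe_le_coe.2 (Finset.le_sup (f := id) hp)) α.2.1
  · obtain ⟨p, hp, h⟩ := Finset.exists_mem_eq_sup (availablePrizes y S)
      (Finset.insert_nonempty _ _) id
    rw [h]
    exact Finset.le_sup' (linearContract α).wage hp

/-- Under a linear contract the agent presents the largest prize he has found. -/
lemma presentedPrize_linearContract (y : A → ℝ≥0) (S : Finset A) :
    presentedPrize (linearContract α) y S = S.sup y := by
  rw [← sup_availablePrizes y S]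
  apply le_antisymm
  · exact Finset.sup_mono (Finset.filter_subset _ _)
  · obtain ⟨p, hp, h⟩ := Finset.exists_mem_eq_sup (availablePrizes y S)
      (Finset.insert_nonempty _ _) id
    rw [h]
    refine Finset.le_sup (f := id) (Finset.mem_filter.2 ⟨hp, ?_⟩)
    rw [bestWage_linearContract, ← sup_availablePrizes y S, h]
    rfl

lemma finalPrize_linearContract (σ : Strategy A) (y : A → ℝ≥0) :
    finalPrize (linearContract α) σ y = (sampled (linearContract α) σ y).sup y :=
  presentedPrize_linearContract α y _

end LinearContract

section Strategies

variable {A : Finset Project}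

lemma subset_step (w : Contract) (σ : Strategy A) (y : A → ℝ≥0) (S : Finset A) :
    S ⊆ step w σ y S := by
  unfold step
  split
  · exact subset_rfl
  · exact Finset.subset_insert _ _

lemma step_of_next_eq_none {w : Contract} {σ : Strategy A} {y : A → ℝ≥0} {S : Finset A}
    (h : σ.next S (bestWage w y S) = none) : step w σ y S = S := by
  simp [step, h]

lemma step_of_next_eq_some {w : Contract} {σ : Strategy A} {y : A → ℝ≥0} {S : Finset A} {a : A}
    (h : σ.next S (bestWage w y S) = some a) : step w σ y S = insert a S := by
  simp [step, h]

lemma measurable_sup_apply (S : Finset A) : Measurable fun y : A → ℝ≥0 => S.sup y := by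
  induction S using Finset.induction_on with
  | empty => simp
  | insert a S _ ih =>
    simp only [Finset.sup_insert]
    exact (measurable_pi_apply a).sup ih

lemma measurableSet_step_eq (α : Set.Icc (0 : ℝ) 1) (σ : Strategy A) (S T : Finset A) :
    MeasurableSet {y : A → ℝ≥0 | step (linearContract α) σ y S = T} := by
  have hm : Measurable fun y : A → ℝ≥0 => bestWage (linearContract α) y S := by
    simp only [bestWage_linearContract]
    exact (measurable_sup_apply S).coe_nnreal_real.const_mul _
  have h : {y : A → ℝ≥0 | step (linearContract α) σ y S = T} =
      ⋃ o ∈ {o : Option A | (match o with | none => S | some a => insert a S) = T},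
        {y | σ.next S (bestWage (linearContract α) y S) = o} := by
    ext y
    simp [step]
  rw [h]
  exact MeasurableSet.biUnion (Set.to_countable _) fun o _ => hm (σ.measurable_next S o)

lemma measurableSet_iterate_step_eq (α : Set.Icc (0 : ℝ) 1) (σ : Strategy A) (n : ℕ)
    (T : Finset A) :
    MeasurableSet {y : A → ℝ≥0 | (step (linearContract α) σ y)^[n] ∅ = T} := by
  induction n generalizing T with
  | zero => simp
  | succ n ih =>
    have h : {y : A → ℝ≥0 | (step (linearContract α) σ y)^[n + 1] ∅ = T} =
        ⋃ S : Finset A, {y | (step (linearContract α) σ y)^[n] ∅ = S} ∩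
          {y | step (linearContract α) σ y S = T} := by
      ext y
      simp [Function.iterate_succ_apply']
    rw [h]
    exact MeasurableSet.iUnion fun S => (ih S).inter (measurableSet_step_eq α σ S T)

/-- A function of the prizes and of the set of sampled projects is measurable as soon as it is
measurable in the prizes. -/
lemma measurable_comp_sampled (α : Set.Icc (0 : ℝ) 1) (σ : Strategy A)
    {f : Finset A → (A → ℝ≥0) → ℝ} (hf : ∀ S, Measurable (f S)) :
    Measurable fun y => f (sampled (linearContract α) σ y) y := by
  intro s hs
  have h : (fun y => f (sampled (linearContract α) σ y) y) ⁻¹' s =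
      ⋃ S : Finset A, {y | sampled (linearContract α) σ y = S} ∩ f S ⁻¹' s := by
    ext y
    simp
  rw [h]
  exact MeasurableSet.iUnion fun S =>
    (measurableSet_iterate_step_eq α σ _ S).inter (hf S hs)

end Strategies

section PrizeLaw

variable {A : Finset Project}

instance (A : Finset Project) : IsProbabilityMeasure (prizeLaw A) := by
  unfold prizeLaw
  infer_instance

lemma measurePreserving_prize (a : A) :
    MeasurePreserving (fun y : A → ℝ≥0 => y a) (prizeLaw A) (a.1.dist : Measure ℝ≥0) :=
  measurePreserving_eval (fun a : A => (a.1.dist : Measure ℝ≥0)) a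

lemma integral_comp_prize (a : A) {f : ℝ≥0 → ℝ} (hf : Measurable f) :
    ∫ y, f (y a) ∂(prizeLaw A) = ∫ x, f x ∂(a.1.dist : Measure ℝ≥0) := by
  rw [← (measurePreserving_prize a).map_eq]
  exact (integral_map (measurable_pi_apply a).aemeasurable hf.aestronglyMeasurable).symm

lemma integrable_prize (a : A) : Integrable (fun y : A → ℝ≥0 => (y a : ℝ)) (prizeLaw A) :=
  (measurePreserving_prize a).integrable_comp_of_integrable a.1.finite_expectation

lemma integrable_agentPayoff (α : Set.Icc (0 : ℝ) 1) (σ : Strategy A) :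
    Integrable (fun y => (linearContract α).wage (finalPrize (linearContract α) σ y) -
      ∑ a ∈ sampled (linearContract α) σ y, (a.1.cost : ℝ)) (prizeLaw A) := by
  have hm : Measurable fun y => (linearContract α).wage (finalPrize (linearContract α) σ y) -
      ∑ a ∈ sampled (linearContract α) σ y, (a.1.cost : ℝ) := by
    simp only [finalPrize_linearContract]
    exact measurable_comp_sampled α σ (f := fun S y => (linearContract α).wage (S.sup y) -
      ∑ a ∈ S, (a.1.cost : ℝ)) fun S =>
        ((linearContract α).measurable_wage.comp (measurable_sup_apply S)).sub_const _
  refine Integrable.mono' (g := fun y => (∑ a : A, (y a : ℝ)) + ∑ a : A, (a.1.cost : ℝ))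
    ((integrable_finsetSum _ fun a _ => integrable_prize a).add (integrable_const _))
    hm.aestronglyMeasurable (Filter.Eventually.of_forall fun y => ?_)
  have h1 : (finalPrize (linearContract α) σ y : ℝ) ≤ ∑ a : A, (y a : ℝ) := by
    rw [finalPrize_linearContract, ← NNReal.coe_sum, NNReal.coe_le_coe]
    exact Finset.sup_le fun a _ => Finset.single_le_sum (f := y) (fun _ _ => zero_le)
      (Finset.mem_univ a)
  have h2 : ∑ a ∈ sampled (linearContract α) σ y, (a.1.cost : ℝ) ≤ ∑ a : A, (a.1.cost : ℝ) :=
    Finset.sum_le_sum_of_subset_of_nonneg (Finset.subset_univ _) fun a _ _ => a.1.cost.2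
  have h3 : 0 ≤ ∑ a ∈ sampled (linearContract α) σ y, (a.1.cost : ℝ) :=
    Finset.sum_nonneg fun a _ => a.1.cost.2
  have h4 := (linearContract α).wage_nonneg (finalPrize (linearContract α) σ y)
  have h5 : (linearContract α).wage (finalPrize (linearContract α) σ y) ≤
      finalPrize (linearContract α) σ y :=
    mul_le_of_le_one_left (NNReal.coe_nonneg _) α.2.2
  rw [Real.norm_eq_abs, abs_le]
  constructor <;> linarith

/-- If the presented prize is at most `g`, then the principal gets at most `(1 - α) 𝔼[g]`. -/
lemma principalPayoff_le (α : Set.Icc (0 : ℝ) 1) (σ : Strategy A) {g : (A → ℝ≥0) → ℝ}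
    (hg : Integrable g (prizeLaw A))
    (h : ∀ᵐ y ∂(prizeLaw A), (finalPrize (linearContract α) σ y : ℝ) ≤ g y) :
    principalPayoff (linearContract α) σ ≤ (1 - α) * ∫ y, g y ∂(prizeLaw A) := by
  have hα : (0 : ℝ) ≤ 1 - α := sub_nonneg.2 α.2.2
  have he : ∀ p : ℝ≥0, (p : ℝ) - (linearContract α).wage p = (1 - α) * p := fun p => by
    simp only [linearContract]
    ring
  rw [principalPayoff, ← integral_const_mul]
  simp only [he]
  refine integral_mono_of_nonneg (Filter.Eventually.of_forall fun y => by positivity)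
    (hg.const_mul _) ?_
  filter_upwards [h] with y hy using mul_le_mul_of_nonneg_left hy hα

end PrizeLaw

/-- If only `a` is available, then the principal gets at most `(1 - α) 𝔼[y]`. -/
lemma payoffGiven_singleton_le (a : Project) (α : Set.Icc (0 : ℝ) 1) :
    payoffGiven (linearContract α) {a} ≤
      (((1 - α) * ∫ x : ℝ≥0, (x : ℝ) ∂(a.dist : Measure ℝ≥0) : ℝ) : EReal) := by
  refine iSup₂_le fun σ _ => EReal.coe_le_coe_iff.2 ?_
  let b : ({a} : Finset Project) := ⟨a, Finset.mem_singleton_self a⟩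
  have h := principalPayoff_le α σ (integrable_prize b) (Filter.Eventually.of_forall fun y => by
    rw [finalPrize_linearContract, NNReal.coe_le_coe]
    refine Finset.sup_le fun c _ => ?_
    have : c = b := Subtype.ext (Finset.mem_singleton.1 c.2)
    rw [this])
  rwa [integral_comp_prize b (f := fun x => (x : ℝ)) measurable_coe_nnreal_real] at h

/-- The project that yields the prize `z` for sure at no cost. -/
def safeProject (z : ℝ≥0) : Project where
  dist := ⟨Measure.dirac z, inferInstance⟩
  cost := 0
  finite_expectation := integrable_dirac (by simp)

/-- The strategy that samples only the project `b`. -/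
def onlyStrategy {A : Finset Project} (b : A) : Strategy A where
  next S _ := if S = ∅ then some b else none
  not_sampled S v a h := by
    split_ifs at h with hS
    simp [hS]
  measurable_next S o := MeasurableSet.const _

section Pair

variable {A : Finset Project}

lemma sampled_onlyStrategy (w : Contract) (b : A) (y : A → ℝ≥0) :
    sampled w (onlyStrategy b) y = {b} := by
  have h0 : step w (onlyStrategy b) y ∅ = {b} := by simp [step, onlyStrategy]
  have h1 : step w (onlyStrategy b) y {b} = {b} := by simp [step, onlyStrategy]
  obtain ⟨n, hn⟩ := Nat.exists_eq_succ_of_ne_zero (Fintype.card_pos_iff.2 ⟨b⟩).ne'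
  rw [sampled, hn, Function.iterate_succ_apply, h0, Function.iterate_fixed h1]

lemma ae_prize_safeProject {z : ℝ≥0} {b : A} (hb : b.1 = safeProject z) :
    ∀ᵐ y ∂(prizeLaw A), y b = z := by
  have h : ∀ᵐ x ∂(b.1.dist : Measure ℝ≥0), x = z := by
    rw [hb]
    change ∀ᵐ x ∂(Measure.dirac z), x = z
    simp [ae_dirac_eq]
  exact (measurePreserving_prize b).quasiMeasurePreserving.ae h

lemma agentPayoff_onlyStrategy_safeProject (α : Set.Icc (0 : ℝ) 1) {z : ℝ≥0} {b : A}
    (hb : b.1 = safeProject z) :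
    agentPayoff (linearContract α) (onlyStrategy b) = α * z := by
  have h : ∀ᵐ y ∂(prizeLaw A),
      (linearContract α).wage (finalPrize (linearContract α) (onlyStrategy b) y) -
        ∑ a ∈ sampled (linearContract α) (onlyStrategy b) y, (a.1.cost : ℝ) = α * z := by
    filter_upwards [ae_prize_safeProject hb] with y hy
    rw [finalPrize_linearContract, sampled_onlyStrategy]
    simp [hy, hb, safeProject, linearContract]
  rw [agentPayoff, integral_congr_ae h]
  simp

/-- With a safe project and one other project `b`, whether `b` is sampled is not random. -/
lemma ae_mem_sampled_or_ae_notMem_sampled (α : Set.Icc (0 : ℝ) 1) {z : ℝ≥0} {b b' : A}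
    (hb' : b'.1 = safeProject z) (hbb' : b ≠ b') (hA : ∀ a : A, a = b ∨ a = b')
    (σ : Strategy A) :
    (∀ᵐ y ∂(prizeLaw A), b ∈ sampled (linearContract α) σ y) ∨
      ∀ᵐ y ∂(prizeLaw A), b ∉ sampled (linearContract α) σ y := by
  have hcard : Fintype.card A = 2 := by
    have : (Finset.univ : Finset A) = {b, b'} := by
      ext a
      simpa using hA a
    rw [← Finset.card_univ, this, Finset.card_pair hbb']
  have hs : ∀ y, sampled (linearContract α) σ y =
      step (linearContract α) σ y (step (linearContract α) σ y ∅) := fun y => by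
    rw [sampled, hcard]
    rfl
  have h0 : ∀ y : A → ℝ≥0, bestWage (linearContract α) y ∅ = 0 := fun y => by
    simp [bestWage_linearContract]
  rcases hn : σ.next ∅ 0 with _ | a
  · right
    refine Filter.Eventually.of_forall fun y => ?_
    have h1 : step (linearContract α) σ y ∅ = ∅ := step_of_next_eq_none (by rw [h0, hn])
    simp [hs, h1]
  have h1 : ∀ y, step (linearContract α) σ y ∅ = {a} := fun y => by
    rw [step_of_next_eq_some (by rw [h0, hn]), insert_empty_eq]
  rcases hA a with rfl | rfl
  · left
    refine Filter.Eventually.of_forall fun y => ?_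
    rw [hs, h1]
    exact subset_step _ _ _ _ (Finset.mem_singleton_self _)
  have h2 : ∀ᵐ y ∂(prizeLaw A), bestWage (linearContract α) y {a} = α * z := by
    filter_upwards [ae_prize_safeProject hb'] with y hy
    simp [bestWage_linearContract, hy]
  rcases hn' : σ.next {a} (α * z) with _ | a'
  · right
    filter_upwards [h2] with y hy
    rw [hs, h1, step_of_next_eq_none (by rw [hy, hn'])]
    simpa using hbb'
  · left
    filter_upwards [h2] with y hy
    have ha' : a' = b := (hA a').resolve_right fun h =>
      σ.not_sampled _ _ _ hn' (by simp [h])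
    rw [hs, h1, step_of_next_eq_some (by rw [hy, hn']), ha']
    exact Finset.mem_insert_self _ _

/-- If the expected gain of `b` over a safe prize does not cover its cost, then the agent does not
sample `b`, and the principal gets at most the safe prize. -/
lemma principalPayoff_le_of_safeProject (α : Set.Icc (0 : ℝ) 1) {z : ℝ≥0} {b b' : A}
    (hb' : b'.1 = safeProject z) (hbb' : b ≠ b') (hA : ∀ a : A, a = b ∨ a = b')
    (hα : α * ∫ x : ℝ≥0, ((x - z : ℝ≥0) : ℝ) ∂(b.1.dist : Measure ℝ≥0) < b.1.cost)
    {σ : Strategy A} (hσ : σ ∈ optimalStrategies (linearContract α) A) :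
    principalPayoff (linearContract α) σ ≤ z := by
  have hz := ae_prize_safeProject hb'
  rcases ae_mem_sampled_or_ae_notMem_sampled α hb' hbb' hA σ with h | h
  · exfalso
    have hm : Measurable fun x : ℝ≥0 => ((x - z : ℝ≥0) : ℝ) := by fun_prop
    have hi : Integrable (fun y : A → ℝ≥0 => ((y b - z : ℝ≥0) : ℝ)) (prizeLaw A) := by
      refine (integrable_prize b).mono' (hm.comp (measurable_pi_apply b)).aestronglyMeasurable
        (Filter.Eventually.of_forall fun y => ?_)
      rw [Real.norm_of_nonneg (NNReal.coe_nonneg _)]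
      exact NNReal.coe_le_coe.2 tsub_le_self
    have hle : agentPayoff (linearContract α) σ ≤
        ∫ y, ((α : ℝ) * ((y b - z : ℝ≥0) : ℝ) + (α * z - b.1.cost)) ∂(prizeLaw A) := by
      refine integral_mono_ae (integrable_agentPayoff α σ)
        ((hi.const_mul _).add (integrable_const _)) ?_
      filter_upwards [h, hz] with y hy hyz
      have h1 : (finalPrize (linearContract α) σ y : ℝ) ≤ ((y b - z : ℝ≥0) : ℝ) + z := by
        rw [finalPrize_linearContract, ← NNReal.coe_add, NNReal.coe_le_coe]
        refine Finset.sup_le fun a _ => ?_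
        rcases hA a with rfl | rfl
        · exact le_tsub_add
        · rw [hyz]
          exact le_add_self
      have h2 : (b.1.cost : ℝ) ≤ ∑ a ∈ sampled (linearContract α) σ y, (a.1.cost : ℝ) :=
        Finset.single_le_sum (f := fun a : A => (a.1.cost : ℝ)) (fun a _ => a.1.cost.2) hy
      have h3 := mul_le_mul_of_nonneg_left h1 α.2.1
      change (α : ℝ) * _ - _ ≤ _
      linarith
    rw [integral_add (hi.const_mul _) (integrable_const _), integral_const_mul,
      integral_comp_prize b hm] at hle
    have hopt := hσ (onlyStrategy b')
    rw [agentPayoff_onlyStrategy_safeProject α hb'] at hopt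
    simp only [integral_const, probReal_univ, one_smul] at hle
    linarith
  · have hle := principalPayoff_le α σ (g := fun _ => (z : ℝ)) (integrable_const _) (by
      filter_upwards [h, hz] with y hy hyz
      rw [finalPrize_linearContract, NNReal.coe_le_coe]
      refine Finset.sup_le fun a ha => ?_
      rcases hA a with rfl | rfl
      · exact absurd ha hy
      · exact hyz.le)
    simp only [integral_const, probReal_univ, one_smul] at hle
    exact hle.trans (mul_le_of_le_one_left z.2 (sub_le_self _ α.2.1))

end Pair

lemma payoffGiven_safeProject_le (a : Project) (α : Set.Icc (0 : ℝ) 1) (z : ℝ≥0)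
    (hα : α * ∫ x : ℝ≥0, ((x - z : ℝ≥0) : ℝ) ∂(a.dist : Measure ℝ≥0) < a.cost)
    (ha : 0 < a.cost) :
    payoffGiven (linearContract α) {a, safeProject z} ≤ ((z : ℝ) : EReal) := by
  refine iSup₂_le fun σ hσ => EReal.coe_le_coe_iff.2 ?_
  have hne : a ≠ safeProject z := fun h => by
    rw [h] at ha
    exact lt_irrefl _ ha
  refine principalPayoff_le_of_safeProject (b := ⟨a, by simp⟩) (b' := ⟨safeProject z, by simp⟩)
    α rfl (fun h => hne (Subtype.ext_iff.1 h)) (fun c => ?_) hα hσ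
  rcases Finset.mem_insert.1 c.2 with h | h
  · exact Or.inl (Subtype.ext h)
  · exact Or.inr (Subtype.ext (Finset.mem_singleton.1 h))

/-- A positive safe prize strictly lowers the expected gain from a project whose expected prize is
positive. -/
lemma integral_tsub_lt (a : Project) {z : ℝ≥0} (hz : 0 < z)
    (ha : 0 < ∫ x : ℝ≥0, (x : ℝ) ∂(a.dist : Measure ℝ≥0)) :
    ∫ x : ℝ≥0, ((x - z : ℝ≥0) : ℝ) ∂(a.dist : Measure ℝ≥0) <
      ∫ x : ℝ≥0, (x : ℝ) ∂(a.dist : Measure ℝ≥0) := by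
  have hle : ∀ x : ℝ≥0, ((x - z : ℝ≥0) : ℝ) ≤ x := fun x => NNReal.coe_le_coe.2 tsub_le_self
  have hi : Integrable (fun x : ℝ≥0 => ((x - z : ℝ≥0) : ℝ)) (a.dist : Measure ℝ≥0) := by
    refine a.finite_expectation.mono' (by fun_prop) (Filter.Eventually.of_forall fun x => ?_)
    rw [Real.norm_of_nonneg (NNReal.coe_nonneg _)]
    exact hle x
  refine lt_of_le_of_ne (integral_mono hi a.finite_expectation hle) fun h => ha.ne' ?_
  have h0 := (integral_eq_iff_of_ae_le hi a.finite_expectation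
    (Filter.Eventually.of_forall hle)).1 h
  rw [integral_eq_zero_of_ae]
  filter_upwards [h0] with x hx
  by_contra hx0
  have hpos : 0 < x := pos_iff_ne_zero.2 fun h => hx0 (by simp [h])
  exact (tsub_lt_self hpos hz).ne (NNReal.coe_injective hx)

end RobustSearch

end

theorem mainTheorem8 (a₀ : RobustSearch.Project) (hc : 0 < a₀.cost) (hs : 0 < a₀.surplus) :
    (⨆ α : Set.Icc (0 : ℝ) 1, RobustSearch.payoffGuarantee a₀ (RobustSearch.linearContract α)) <
      (a₀.surplus : EReal) := by
  set m : ℝ := ∫ x : ℝ≥0, (x : ℝ) ∂(a₀.dist : Measure ℝ≥0) with hm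
  have hsm : a₀.surplus = m - a₀.cost := rfl
  have hc' : (0 : ℝ) < a₀.cost := hc
  have hm0 : 0 < m := by linarith
  obtain ⟨z, hz⟩ : ∃ z : ℝ≥0, (z : ℝ) = a₀.surplus / 2 := ⟨⟨_, (half_pos hs).le⟩, rfl⟩
  have hz0 : 0 < z := NNReal.coe_pos.1 (by linarith)
  set M : ℝ := ∫ x : ℝ≥0, ((x - z : ℝ≥0) : ℝ) ∂(a₀.dist : Measure ℝ≥0) with hM
  have hMm : M < m := RobustSearch.integral_tsub_lt a₀ hz0 hm0
  have hd : 0 < a₀.cost / m * (m - M) := mul_pos (div_pos hc' hm0) (sub_pos.2 hMm)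
  have hlt : max (z : ℝ) (a₀.surplus - a₀.cost / m * (m - M)) < a₀.surplus :=
    max_lt (by linarith) (by linarith)
  refine lt_of_le_of_lt (iSup_le fun α => ?_) (EReal.coe_lt_coe_iff.2 hlt)
  rcases lt_or_ge (α * M) a₀.cost with h | h
  · refine (iInf₂_le {a₀, RobustSearch.safeProject z} (by simp)).trans
      ((RobustSearch.payoffGiven_safeProject_le a₀ α z h hc).trans ?_)
    exact EReal.coe_le_coe_iff.2 (le_max_left _ _)
  · refine (iInf₂_le {a₀} (by simp)).trans
      ((RobustSearch.payoffGiven_singleton_le a₀ α).trans ?_)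
    refine EReal.coe_le_coe_iff.2 (le_trans ?_ (le_max_right _ _))
    have h1 : a₀.cost / m ≤ (α : ℝ) :=
      (div_le_iff₀ hm0).2 (h.trans (mul_le_mul_of_nonneg_left hMm.le α.2.1))
    have h2 := mul_le_mul_of_nonneg_right h1 (sub_pos.2 hMm).le
    rw [← hm, hsm]
    linarith
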